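/- Theorem 2 (Upper bound for heteroclinic trajectory). Let $J\subseteq\mathbb R$ be an interval, let $a,b:J\to\mathbb R$ be of class $C^1$ with $b\ge 0$ on $J$ (one-sided derivatives at end points of $J$ belonging to $J$), and consider the system $$x'=y-x,\qquad y'=a(x)\,y-b(x)\,y^2 .$$ Assume $0\in J$, $a(0)>0$, and that there are a function $r:J\to[0,\infty)$ and constants $w,z$ with $z\in J$ and $(a(0)+1)w>z\ge w>0$ such that 1. $z\,b(x)-a(x)=-r(x)(z-x)$ for all $x\in J$; 2. $(a(0)+1)\,w\,b(w)=a(w)$; 3. $(a(0)+1)\,x\,b(x)\ge a(x)-a(0)$ for $0\le x\le w$; 4. $a'(x)-b'(x)\,y<0$ for all $x\in[w,z]$ and $y\in[z,(a(0)+1)w]$. Let $A,B$ be the primitives of $a,b$ on $J$ with $A(z)=B(z)=0$, put $H(x)=zB(x)-A(x)$ for $x\in J$, $x\ge z$, and let $X\in J$, $X\ge z$, be such that $$H(X)=(a(0)+1)w-z-z\log\frac{(a(0)+1)w}{z},$$ that is, $X=H^{-1}\big((a(0)+1)w-z-z\log((a(0)+1)w/z)\big)$ when $H$ is injective. Then every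 heteroclinic trajectory joining $(0,0)$ with $(z,z)$, i.e. every solution $(x,y):\mathbb R\to J\times\mathbb R$ of the system with $(x,y)(t)\to(0,0)$ as $t\to-\infty$ and $(x,y)(t)\to(z,z)$ as $t\to+\infty$, satisfies $x(t)\le X$ for all $t\in\mathbb R$. -/

import Mathlib

open Set Filter Topology

/-- `t ↦ (x t, y t)` is a global solution of the planar system
`x' = y - x`, `y' = a(x) y - b(x) y ^ 2`, where `a` and `b` are only considered on `J`. -/
structure IsSolution (J : Set ℝ) (a b x y : ℝ → ℝ) : Prop where
  mem : ∀ t, x t ∈ J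
  deriv_x : ∀ t, HasDerivAt x (y t - x t) t
  deriv_y : ∀ t, HasDerivAt y (a (x t) * y t - b (x t) * y t ^ 2) t

/-- `t ↦ (x t, y t)` is a trajectory of the system joining the point `P` (as `t → -∞`)
with the point `Q` (as `t → +∞`). -/
structure IsTrajectoryJoining (J : Set ℝ) (a b : ℝ → ℝ) (P Q : ℝ × ℝ) (x y : ℝ → ℝ) : Prop
    extends IsSolution J a b x y where
  tendsto_atBot : Tendsto (fun t => (x t, y t)) atBot (𝓝 P)
  tendsto_atTop : Tendsto (fun t => (x t, y t)) atTop (𝓝 Q)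

/-- `F` is the primitive of `f` on the interval `J` that vanishes at `z`
(one-sided derivatives at end points of `J` that belong to `J`). -/
structure IsPrimitiveVanishingAt (J : Set ℝ) (z : ℝ) (f F : ℝ → ℝ) : Prop where
  deriv : ∀ x ∈ J, HasDerivWithinAt F (f x) J x
  zero : F z = 0

/-! Put c = a(0) + 1, the slope of the unstable direction at the origin. The trajectory is positive;
in the strip x ≤ w it stays below y = c x (`y_le_mul_x`), hence below y = c w where x ≥ w
(`y_le_mul_of_le_x`). The function V = H(x) + y - z log(y/z) decreases along it
(`antitone_lyapunov`). If x exceeded X, then at the preceding crossing of x = z one has z ≤ y ≤ c w,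
so V ≤ H(X) + z from then on. Where x > X, H(x) ≥ H(X) forces y = z. Then x' = z - x < 0, so x could
not have risen above X. -/

/-- If a continuous function is at most `k` at `u` and exceeds `k` at a later time `t`, then there
is a last time before `t` at which it takes the value `k`. -/
lemma exists_last_eq_of_continuous {f : ℝ → ℝ} (hf : Continuous f) {k u t : ℝ} (hut : u ≤ t)
    (hu : f u ≤ k) (ht : k < f t) : ∃ s < t, f s = k ∧ ∀ τ ∈ Ioc s t, k < f τ := by
  have hcomp : IsCompact (Icc u t ∩ f ⁻¹' Iic k) :=
    isCompact_Icc.inter_right (isClosed_Iic.preimage hf)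
  obtain ⟨s, ⟨hs, hsk⟩, hmax⟩ := hcomp.exists_isGreatest ⟨u, ⟨le_rfl, hut⟩, hu⟩
  have hsk : f s ≤ k := hsk
  have hst : s < t := lt_of_le_of_ne hs.2 (by rintro rfl; linarith)
  have hgt : ∀ τ ∈ Ioc s t, k < f τ := by
    intro τ hτ
    by_contra! h
    exact absurd (hmax ⟨⟨hs.1.trans hτ.1.le, hτ.2⟩, h⟩) (not_le.mpr hτ.1)
  refine ⟨s, hst, le_antisymm hsk ?_, hgt⟩
  refine ge_of_tendsto (hf.continuousWithinAt (s := Ioi s) (x := s)) ?_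
  filter_upwards [Ioc_mem_nhdsGT hst] with τ hτ using (hgt τ hτ).le

/-- A function which lies above its value at `s` on an interval to the right of `s` has a
nonnegative derivative at `s`. -/
lemma HasDerivAt.nonneg_of_le_right {f : ℝ → ℝ} {f' s t : ℝ} (hf : HasDerivAt f f' s)
    (hst : s < t) (h : ∀ τ ∈ Ioc s t, f s ≤ f τ) : 0 ≤ f' := by
  have hslope := hasDerivWithinAt_iff_tendsto_slope' (notMem_Ioi.mpr le_rfl) |>.mp
    (hf.hasDerivWithinAt (s := Ioi s))
  refine ge_of_tendsto hslope ?_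
  filter_upwards [Ioc_mem_nhdsGT hst] with τ hτ
  rw [slope_def_field]
  exact div_nonneg (sub_nonneg.mpr (h τ hτ)) (sub_nonneg.mpr hτ.1.le)

/-- A differentiable function whose derivative is nonpositive on `(s, t)` is antitone on
`[s, t]`. -/
lemma antitoneOn_Icc_of_hasDerivAt_nonpos {f f' : ℝ → ℝ} {s t : ℝ}
    (hf : ∀ τ, HasDerivAt f (f' τ) τ) (h : ∀ τ ∈ Ioo s t, f' τ ≤ 0) :
    AntitoneOn f (Icc s t) := by
  refine antitoneOn_of_deriv_nonpos (convex_Icc s t)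
    (fun τ _ => (hf τ).continuousAt.continuousWithinAt)
    (fun τ _ => (hf τ).differentiableAt.differentiableWithinAt) fun τ hτ => ?_
  rw [(hf τ).deriv]
  exact h τ (by rwa [interior_Icc] at hτ)

/-- A solution of a scalar linear homogeneous equation is positive everywhere as soon as it is
positive somewhere. -/
lemma pos_of_hasDerivAt_mul {y g : ℝ → ℝ} (hg : Continuous g)
    (hy : ∀ t, HasDerivAt y (g t * y t) t) {t₀ : ℝ} (h₀ : 0 < y t₀) (t : ℝ) : 0 < y t := by
  have hG : ∀ t, HasDerivAt (fun t => ∫ s in (0 : ℝ)..t, g s) (g t) t := fun t =>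
    (hg.integral_hasStrictDerivAt 0 t).hasDerivAt
  set G : ℝ → ℝ := fun t => ∫ s in (0 : ℝ)..t, g s
  have hd : ∀ t, HasDerivAt (fun t => y t * Real.exp (-G t)) 0 t := by
    intro t
    refine ((hy t).mul (hG t).neg.exp).congr_deriv ?_
    simp only [Pi.neg_apply]
    ring
  have hc := is_const_of_deriv_eq_zero (fun t => (hd t).differentiableAt)
    (fun t => (hd t).deriv) t t₀
  have hpos : 0 < y t₀ * Real.exp (-G t₀) := mul_pos h₀ (Real.exp_pos _)
  rw [← hc] at hpos
  exact pos_of_mul_pos_left hpos (Real.exp_pos _).le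

/-- The function `y - z - z log (y / z)` is nonnegative for positive `y` and `z`, and vanishes only
at `y = z`. -/
lemma mul_log_div_lt_sub {y z : ℝ} (hy : 0 < y) (hz : 0 < z) (hne : y ≠ z) :
    z * Real.log (y / z) < y - z := by
  have h := Real.log_lt_sub_one_of_pos (div_pos hy hz) (by rwa [Ne, div_eq_one_iff_eq hz.ne'])
  have := mul_lt_mul_of_pos_left h hz
  rwa [mul_sub, mul_div_cancel₀ _ hz.ne', mul_one] at this

/-- The function `y - z * log (y / z)` is increasing for `z ≤ y`. -/
lemma sub_mul_log_div_le {y y' z : ℝ} (hz : 0 < z) (hy : z ≤ y) (hyy' : y ≤ y') :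
    y - z * Real.log (y / z) ≤ y' - z * Real.log (y' / z) := by
  have hy0 : 0 < y := hz.trans_le hy
  have hy0' : 0 < y' := hy0.trans_le hyy'
  have h := Real.log_le_sub_one_of_pos (div_pos hy0' hy0)
  have hl : Real.log (y' / z) = Real.log (y' / y) + Real.log (y / z) := by
    rw [← Real.log_mul (by positivity) (by positivity)]
    congr 1
    field_simp
  have hq : z * (y' / y - 1) ≤ y * (y' / y - 1) :=
    mul_le_mul_of_nonneg_right hy (sub_nonneg.mpr ((one_le_div hy0).mpr hyy'))
  have hq' : y * (y' / y - 1) = y' - y := by field_simp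
  have := mul_le_mul_of_nonneg_left h hz.le
  rw [hl, mul_add]
  linarith

/-! ### Positivity, barriers and the Lyapunov function along solutions -/

namespace IsSolution

variable {J : Set ℝ} {a b x y : ℝ → ℝ}

lemma continuous_x (h : IsSolution J a b x y) : Continuous x :=
  continuous_iff_continuousAt.mpr fun t => (h.deriv_x t).continuousAt

lemma continuous_y (h : IsSolution J a b x y) : Continuous y :=
  continuous_iff_continuousAt.mpr fun t => (h.deriv_y t).continuousAt

lemma y_pos (h : IsSolution J a b x y) (ha : ContinuousOn a J) (hb : ContinuousOn b J)
    {t₀ : ℝ} (h₀ : 0 < y t₀) (t : ℝ) : 0 < y t := by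
  refine pos_of_hasDerivAt_mul (g := fun t => a (x t) - b (x t) * y t)
    ((ha.comp_continuous h.continuous_x h.mem).sub
      ((hb.comp_continuous h.continuous_x h.mem).mul h.continuous_y)) (fun t => ?_) h₀ t
  refine (h.deriv_y t).congr_deriv ?_
  ring

/-- By x' + x = y, the product e^t x increases strictly, and it starts from the limit 0 at -∞. -/
lemma x_pos (h : IsSolution J a b x y) (hy : ∀ t, 0 < y t) (hx : Tendsto x atBot (𝓝 0)) (t : ℝ) :
    0 < x t := by
  have hd : ∀ t, HasDerivAt (fun t => Real.exp t * x t) (Real.exp t * y t) t := by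
    intro t
    refine ((Real.hasDerivAt_exp t).mul (h.deriv_x t)).congr_deriv ?_
    ring
  have hmono : StrictMono fun t => Real.exp t * x t :=
    strictMono_of_hasDerivAt_pos hd fun t => mul_pos (Real.exp_pos t) (hy t)
  have hlim : Tendsto (fun t => Real.exp t * x t) atBot (𝓝 0) := by
    simpa using Real.tendsto_exp_atBot.mul hx
  have h1 := hmono.monotone.le_of_tendsto hlim (t - 1)
  have h2 : Real.exp (t - 1) * x (t - 1) < Real.exp t * x t := hmono (sub_one_lt t)
  exact pos_of_mul_pos_right (h1.trans_lt h2) (Real.exp_pos t).le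

/-- A positive solution stays below the line `y = c x` in the strip `0 < x ≤ w`. -/
lemma y_le_mul_x (h : IsSolution J a b x y) (hb0 : ∀ x ∈ J, 0 ≤ b x) (hx : ∀ t, 0 < x t)
    (hy : ∀ t, 0 < y t) {c w : ℝ} (hc : 1 < c)
    (hac : ∀ x ∈ Icc 0 w, a x + 1 ≤ c * x * b x + c) {s : ℝ} (hs : x s ≤ w) :
    y s ≤ c * x s := by
  by_contra! hlt
  have hc0 : 0 < c := by linarith
  -- The relative excess of y over c x: bounded by 1, yet forced to grow linearly backwards in time.
  set v : ℝ → ℝ := fun t => 1 - c * (x t / y t) with hv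
  have hvd : ∀ t, HasDerivAt v (c * ((a (x t) + 1) * (x t / y t) - (b (x t) * x t + 1))) t := by
    intro t
    refine ((((h.deriv_x t).div (h.deriv_y t) (hy t).ne').const_mul c).const_sub 1).congr_deriv ?_
    have := (hy t).ne'
    field_simp
    ring
  have hvc : Continuous v := continuous_iff_continuousAt.mpr fun t => (hvd t).continuousAt
  have hv_pos : ∀ t, 0 < v t ↔ c * x t < y t := by
    intro t
    rw [hv, sub_pos, ← mul_div_assoc, div_lt_one (hy t)]
  have hv' : ∀ t, x t ≤ w → 0 < v t →
      c * ((a (x t) + 1) * (x t / y t) - (b (x t) * x t + 1)) ≤ -c * v t := by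
    -- Since c x / y = 1 - v, `hac` bounds the bracket by -(1 + x b) v ≤ -v.
    intro t ht hvt
    have h1 := mul_le_mul_of_nonneg_right (hac (x t) ⟨(hx t).le, ht⟩)
      (div_pos (hx t) (hy t)).le
    have h2 : 0 ≤ b (x t) * x t * v t :=
      mul_nonneg (mul_nonneg (hb0 _ (h.mem t)) (hx t).le) hvt.le
    have h3 : (a (x t) + 1) * (x t / y t) - (b (x t) * x t + 1) ≤ -v t := by
      have : v t = 1 - c * (x t / y t) := rfl
      rw [this] at h2 ⊢
      nlinarith
    nlinarith
  -- as long as `v` is positive, `x` increases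
  have hxle : ∀ u, (∀ τ ∈ Ioc u s, 0 < v τ) → ∀ τ ∈ Icc u s, x τ ≤ w := by
    intro u hu τ hτ
    have hanti := antitoneOn_Icc_of_hasDerivAt_nonpos (f := fun t => -x t) (s := u) (t := s)
      (fun t => (h.deriv_x t).neg) fun t ht => by
        have := (hv_pos t).mp (hu t ⟨ht.1, ht.2.le⟩)
        have := hx t
        nlinarith
    have := hanti hτ ⟨hτ.1.trans hτ.2, le_rfl⟩ hτ.2
    simp only at this
    linarith
  have hvs : 0 < v s := (hv_pos s).mpr hlt
  have hv_anti : ∀ u, (∀ τ ∈ Ioc u s, 0 < v τ) → AntitoneOn v (Icc u s) := by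
    intro u hu
    refine antitoneOn_Icc_of_hasDerivAt_nonpos hvd fun τ hτ => ?_
    have hτv := hu τ ⟨hτ.1, hτ.2.le⟩
    have := hv' τ (hxle u hu τ ⟨hτ.1.le, hτ.2.le⟩) hτv
    nlinarith
  have hall : ∀ τ ≤ s, 0 < v τ := by
    intro u hu
    by_contra! hle
    obtain ⟨σ, hσs, hσ0, hσ⟩ := exists_last_eq_of_continuous hvc hu hle hvs
    have := hv_anti σ hσ ⟨le_rfl, hσs.le⟩ ⟨hσs.le, le_rfl⟩ hσs.le
    linarith
  -- Before s, v' ≤ -c v(s), so going back by this length raises v by at least 1.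
  set u : ℝ := s - 1 / (c * v s) with hu
  have hcv : 0 < c * v s := mul_pos hc0 hvs
  have hus : u ≤ s := by
    have : 0 < 1 / (c * v s) := by positivity
    linarith
  have hposu : ∀ τ ∈ Ioc u s, 0 < v τ := fun τ hτ => hall τ hτ.2
  have hanti : AntitoneOn (fun t => v t + c * v s * t) (Icc u s) := by
    refine antitoneOn_Icc_of_hasDerivAt_nonpos
      (fun t => (hvd t).add ((hasDerivAt_id t).const_mul (c * v s))) fun τ hτ => ?_
    have h1 := hv' τ (hxle u hposu τ ⟨hτ.1.le, hτ.2.le⟩) (hposu τ ⟨hτ.1, hτ.2.le⟩)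
    have h2 := hv_anti u hposu ⟨hτ.1.le, hτ.2.le⟩ ⟨hus, le_rfl⟩ hτ.2.le
    nlinarith
  have hle := hanti ⟨le_rfl, hus⟩ ⟨hus, le_rfl⟩ hus
  have hmul : c * v s * u = c * v s * s - 1 := by
    rw [hu]
    field_simp
  have hlt1 : v u < 1 := by
    have : 0 < c * (x u / y u) := mul_pos hc0 (div_pos (hx u) (hy u))
    simp only [hv]
    linarith
  simp only at hle
  linarith

/-- If `y` does not increase where `x > w` and `y > c w`, then a solution which is below the line
`y = c x` in the strip `x ≤ w` is below the line `y = c w` in the region `x ≥ w`. -/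
lemma y_le_mul_of_le_x (h : IsSolution J a b x y) (hy : ∀ t, 0 < y t)
    (hy0 : Tendsto y atBot (𝓝 0)) {c w : ℝ} (hcw : 0 < c * w)
    (hstrip : ∀ s, x s ≤ w → y s ≤ c * x s)
    (hab : ∀ x ∈ J, w < x → ∀ y, c * w < y → a x - b x * y ≤ 0) {t : ℝ} (ht : w ≤ x t) :
    y t ≤ c * w := by
  by_contra! hlt
  rcases ht.eq_or_lt with hwx | hwx
  · have := hstrip t hwx.ge
    rw [← hwx] at this
    linarith
  obtain ⟨u, hu, hut⟩ := ((hy0.eventually (gt_mem_nhds hcw)).and (eventually_le_atBot t)).exists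
  -- The time of entry into the region x > w, y > c w. As y decreases inside, entry is through x =
  -- w, where the strip bound applies.
  obtain ⟨s, hst, hs0, hs⟩ := exists_last_eq_of_continuous
    (f := fun t => min (y t - c * w) (x t - w)) (k := 0)
    ((h.continuous_y.sub continuous_const).min (h.continuous_x.sub continuous_const)) hut
    (min_le_of_left_le (by linarith)) (lt_min (by linarith) (by linarith))
  have hanti : AntitoneOn y (Icc s t) := by
    refine antitoneOn_Icc_of_hasDerivAt_nonpos h.deriv_y fun τ hτ => ?_
    have hm := lt_min_iff.mp (hs τ ⟨hτ.1, hτ.2.le⟩)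
    have := mul_nonpos_of_nonpos_of_nonneg
      (hab (x τ) (h.mem τ) (by linarith [hm.2]) (y τ) (by linarith [hm.1])) (hy τ).le
    linarith
  have hys := hanti ⟨le_rfl, hst.le⟩ ⟨hst.le, le_rfl⟩ hst.le
  have hxs : x s = w := by
    rcases min_choice (y s - c * w) (x s - w) with hm | hm <;> rw [hm] at hs0 <;> linarith
  have := hstrip s hxs.le
  rw [hxs] at this
  linarith

/-- The Lyapunov function `z B(x) - A(x) + y - z log (y / z)` does not increase along positive
solutions. -/
lemma antitone_lyapunov (h : IsSolution J a b x y) (hy : ∀ t, 0 < y t) {r A B : ℝ → ℝ} {z : ℝ}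
    (hz : 0 < z) (hb0 : ∀ x ∈ J, 0 ≤ b x) (hr0 : ∀ x ∈ J, 0 ≤ r x)
    (h1 : ∀ x ∈ J, z * b x - a x = -r x * (z - x))
    (hA : ∀ x ∈ J, HasDerivWithinAt A (a x) J x) (hB : ∀ x ∈ J, HasDerivWithinAt B (b x) J x) :
    Antitone fun t => z * B (x t) - A (x t) + (y t - z * Real.log (y t / z)) := by
  have hcomp : ∀ {F f : ℝ → ℝ}, (∀ x ∈ J, HasDerivWithinAt F (f x) J x) →
      ∀ t, HasDerivAt (fun t => F (x t)) (f (x t) * (y t - x t)) t := fun hF t =>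
    (hF (x t) (h.mem t)).comp_hasDerivAt t (h.deriv_x t) (Eventually.of_forall h.mem)
  refine antitone_of_hasDerivAt_nonpos (f' := fun t =>
      -(b (x t) * (y t - z) ^ 2 + r (x t) * (z - x t) ^ 2)) (fun t => ?_) fun t => ?_
  · have hl := ((h.deriv_y t).div_const z).log (div_pos (hy t) hz).ne'
    refine ((((hcomp hB t).const_mul z).sub (hcomp hA t)).add
      ((h.deriv_y t).sub (hl.const_mul z))).congr_deriv ?_
    -- After this substitution the `r` terms combine through (y - z) - (y - x) = x - z.
    have ha : a (x t) = z * b (x t) + r (x t) * (z - x t) := by linarith [h1 (x t) (h.mem t)]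
    rw [ha]
    have := (hy t).ne'
    field_simp
    ring
  · have h2 := mul_nonneg (hb0 _ (h.mem t)) (sq_nonneg (y t - z))
    have h3 := mul_nonneg (hr0 _ (h.mem t)) (sq_nonneg (z - x t))
    simp only [Pi.zero_apply]
    linarith

end IsSolution

/-! ### Monotonicity in x, and the bound -/

/-- A function with `f' = r (x - z)` and `r ≥ 0` on an interval `J` increases to the right
of `z`. -/
lemma le_of_hasDerivWithinAt_mul_sub {J : Set ℝ} (hJ : J.OrdConnected) {H r : ℝ → ℝ} {z p q : ℝ}
    (hH : ∀ x ∈ J, HasDerivWithinAt H (r x * (x - z)) J x) (hr0 : ∀ x ∈ J, 0 ≤ r x)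
    (hp : p ∈ J) (hq : q ∈ J) (hzp : z ≤ p) (hpq : p ≤ q) : H p ≤ H q := by
  have hsub : Icc p q ⊆ J := hJ.out hp hq
  refine monotoneOn_of_hasDerivWithinAt_nonneg (f' := fun x => r x * (x - z)) (convex_Icc p q)
    (fun x hx => ((hH x (hsub hx)).mono hsub).continuousWithinAt) (fun x hx => ?_) (fun x hx => ?_)
    ⟨le_rfl, hpq⟩ ⟨hpq, le_rfl⟩ hpq
  · exact (hH x (hsub (interior_subset hx))).mono (interior_subset.trans hsub)
  · have hx := interior_subset hx
    exact mul_nonneg (hr0 x (hsub hx)) (sub_nonneg.mpr (hzp.trans hx.1))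

/-- If `a' - b' k < 0` on `[w, z]`, then `a - b k` is at most its value at `w` there. -/
lemma sub_mul_le_of_derivWithin_nonpos {J : Set ℝ} (hJ : J.OrdConnected) {a b : ℝ → ℝ}
    {w z k : ℝ} (hwJ : w ∈ J) (hzJ : z ∈ J) (ha : DifferentiableOn ℝ a J)
    (hb : DifferentiableOn ℝ b J)
    (h : ∀ x ∈ Icc w z, derivWithin a J x - derivWithin b J x * k < 0)
    {x : ℝ} (hx : x ∈ Icc w z) : a x - b x * k ≤ a w - b w * k := by
  have hsub : Icc w z ⊆ J := hJ.out hwJ hzJ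
  have hd : ∀ x ∈ Icc w z, HasDerivWithinAt (fun x => a x - b x * k)
      (derivWithin a J x - derivWithin b J x * k) J x := fun x hx =>
    (ha x (hsub hx)).hasDerivWithinAt.sub ((hb x (hsub hx)).hasDerivWithinAt.mul_const k)
  refine antitoneOn_of_hasDerivWithinAt_nonpos
    (f' := fun x => derivWithin a J x - derivWithin b J x * k) (convex_Icc w z)
    (fun x hx => ((hd x hx).mono hsub).continuousWithinAt) (fun x hx => ?_) (fun x hx => ?_)
    ⟨le_rfl, hx.1.trans hx.2⟩ hx hx.1
  · exact (hd x (interior_subset hx)).mono (interior_subset.trans hsub)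
  · exact (h x (interior_subset hx)).le

theorem theorem2 (J : Set ℝ) (hJ : J.OrdConnected) (h0J : (0 : ℝ) ∈ J)
    (a b r A B : ℝ → ℝ) (z w : ℝ) (hzJ : z ∈ J)
    (ha : ContDiffOn ℝ 1 a J) (hb : ContDiffOn ℝ 1 b J)
    (hb0 : ∀ x ∈ J, 0 ≤ b x) (hr0 : ∀ x ∈ J, 0 ≤ r x)
    (hw : 0 < w) (hwz : w ≤ z) (hz : z < (a 0 + 1) * w)
    (h1 : ∀ x ∈ J, z * b x - a x = -r x * (z - x))
    (h2 : (a 0 + 1) * w * b w = a w) (ha0 : 0 < a 0)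
    (h3 : ∀ x ∈ Icc 0 w, a x - a 0 ≤ (a 0 + 1) * x * b x)
    (h4 : ∀ x ∈ Icc w z, ∀ y ∈ Icc z ((a 0 + 1) * w),
      derivWithin a J x - derivWithin b J x * y < 0)
    (hA : IsPrimitiveVanishingAt J z a A) (hB : IsPrimitiveVanishingAt J z b B)
    (X : ℝ) (hXJ : X ∈ J) (hzX : z ≤ X)
    (hX : z * B X - A X = (a 0 + 1) * w - z - z * Real.log ((a 0 + 1) * w / z))
    (x y : ℝ → ℝ) (hxy : IsTrajectoryJoining J a b (0, 0) (z, z) x y) (t : ℝ) :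
    x t ≤ X := by
  have hwJ : w ∈ J := hJ.out h0J hzJ ⟨hw.le, hwz⟩
  have hz0 : 0 < z := hw.trans_le hwz
  have hs : IsSolution J a b x y := hxy.toIsSolution
  have hxbot : Tendsto x atBot (𝓝 0) := hxy.tendsto_atBot.fst_nhds
  have hybot : Tendsto y atBot (𝓝 0) := hxy.tendsto_atBot.snd_nhds
  have hytop : Tendsto y atTop (𝓝 z) := hxy.tendsto_atTop.snd_nhds
  obtain ⟨t₀, ht₀⟩ := (hytop.eventually (lt_mem_nhds hz0)).exists
  have hy := hs.y_pos ha.continuousOn hb.continuousOn ht₀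
  have hx := hs.x_pos hy hxbot
  set c : ℝ := a 0 + 1 with hc
  have hstrip : ∀ s, x s ≤ w → y s ≤ c * x s := fun s =>
    hs.y_le_mul_x hb0 hx hy (by linarith) fun x hx => by linarith [h3 x hx]
  have hab : ∀ x ∈ J, w < x → ∀ y, c * w < y → a x - b x * y ≤ 0 := by
    intro x hxJ hwx y hcy
    have hby : b x * (c * w) ≤ b x * y := mul_le_mul_of_nonneg_left hcy.le (hb0 x hxJ)
    -- Up to z, a - c w b decreases from its value 0 at w (`h2`, `h4`); beyond z, `h1` gives a ≤ z b
    -- ≤ y b.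
    rcases le_total x z with hxz | hzx
    · have := sub_mul_le_of_derivWithin_nonpos hJ hwJ hzJ (ha.differentiableOn one_ne_zero)
        (hb.differentiableOn one_ne_zero) (fun x hx => h4 x hx (c * w) ⟨hz.le, le_rfl⟩)
        (x := x) ⟨hwx.le, hxz⟩
      linarith
    · have h5 := h1 x hxJ
      have h6 := mul_nonneg (hr0 x hxJ) (sub_nonneg.mpr hzx)
      have h7 : b x * z ≤ b x * y := mul_le_mul_of_nonneg_left (by linarith) (hb0 x hxJ)
      linarith
  have hV := hs.antitone_lyapunov hy hz0 hb0 hr0 h1 hA.deriv hB.deriv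
  have hH : ∀ x ∈ J, HasDerivWithinAt (fun x => z * B x - A x) (r x * (x - z)) J x := by
    intro x hx
    refine (((hB.deriv x hx).const_mul z).sub (hA.deriv x hx)).congr_deriv ?_
    linarith [h1 x hx]
  by_contra! hlt
  obtain ⟨u, hu, hut⟩ := ((hxbot.eventually (gt_mem_nhds hz0)).and (eventually_le_atBot t)).exists
  obtain ⟨s, hst, hsX, hsgt⟩ :=
    exists_last_eq_of_continuous hs.continuous_x hut (hu.le.trans hzX) hlt
  -- the last time before `t` at which the trajectory crosses the line `x = z`
  obtain ⟨p, hpt, hpz, hpgt⟩ :=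
    exists_last_eq_of_continuous hs.continuous_x hut hu.le (hzX.trans_lt hlt)
  -- At this crossing x' = y - z cannot be negative.
  have hyp : z ≤ y p := by
    have := (hs.deriv_x p).nonneg_of_le_right hpt fun τ hτ => hpz.trans_le (hpgt τ hτ).le
    linarith
  have hps : p ≤ s := by
    by_contra! hsp
    linarith [hsgt p ⟨hsp, hpt.le⟩]
  have hyp' := sub_mul_log_div_le hz0 hyp
    (hs.y_le_mul_of_le_x hy hybot (by linarith) hstrip hab (hwz.trans hpz.ge))
  -- beyond `X` the Lyapunov function leaves no room for `y ≠ z`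
  have hyz : ∀ τ ∈ Ioo s t, y τ = z := by
    intro τ hτ
    by_contra hne
    have h5 := mul_log_div_lt_sub (hy τ) hz0 hne
    have h6 := hV (hps.trans hτ.1.le)
    have h7 := le_of_hasDerivWithinAt_mul_sub hJ hH hr0 hXJ (hs.mem τ) hzX
      (hsgt τ ⟨hτ.1, hτ.2.le⟩).le
    simp only [hpz, hA.zero, hB.zero] at h6 h7
    linarith
  have hanti := antitoneOn_Icc_of_hasDerivAt_nonpos (s := s) (t := t) hs.deriv_x fun τ hτ => by
    linarith [hyz τ hτ, hsgt τ ⟨hτ.1, hτ.2.le⟩]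
  have := hanti ⟨le_rfl, hst.le⟩ ⟨hst.le, le_rfl⟩ hst.le
  linarith
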